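/- Let $F=\mathbb{F}_q$ be a finite field with $q$ elements. For $a,b\in F^n$ let $A,B$ be the $n\times n$ circulant matrices with first rows $a$ and $b$; the row space $C\subseteq F^{4n}$ of $$\begin{pmatrix} I_n & 0 & A & B\\ 0 & I_n & -B^T & A^T\end{pmatrix}$$ is called a four circulant code of length $4n$. It is self-dual if it equals its dual with respect to the standard inner product of $F^{4n}$. For $0\le t\le \frac{q-1}{q}$ let $H_q$ be the $q$-ary entropy function, $H_q(0)=0$ and $H_q(t)=t\log_q(q-1)-t\log_q t-(1-t)\log_q(1-t)$ for $0<t\le\frac{q-1}{q}$. **Theorem.** Let $n_0<n_1<n_2<\cdots$ be any infinite sequence of odd primes such that, for every $i$, $\gcd(n_i,q)=1$ and $q$ is a primitive root modulo $n_i$. Then there are self-dual four circulant codes $C_i$ over $\mathbb{F}_q$ of length $4n_i$ $(i=0,1,2,\dots)$ such that, with $d(C_i)$ the minimum Hamming distance of $C_i$, the relative distance $$\delta=\liminf_{i\to\infty}\frac{d(C_i)}{4n_i}$$ of the family satisfies $0\le\delta\le\frac{q-1}{q}$ and $H_q(\delta)\ge\frac18$. (That such a sequence of primes exists for a given $q$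 is not part of the theorem; for $q$ not a perfect square it is an instance of Artin's primitive root conjecture.) -/

import Mathlib

open Matrix

namespace FourCirculant

/-- The `4n` coordinate positions of a code of length `4n`, as four consecutive blocks of `n`. -/
abbrev Pos (n : ℕ) : Type := (Fin n ⊕ Fin n) ⊕ (Fin n ⊕ Fin n)

/-- The circulant matrix with first row `a`: its `(i, j)` entry is `a (j - i)`, with indices
taken modulo `n`, so each row is the cyclic shift of the previous one. -/
def circ {R : Type*} {n : ℕ} (a : Fin n → R) : Matrix (Fin n) (Fin n) R :=
  Matrix.of fun i j => a (j - i)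

/-- The generator matrix with block rows `(I, 0, A, B)` and `(0, I, -Bᵀ, Aᵀ)`, where `A` and `B`
are the circulant matrices with first rows `a` and `b`. -/
def generator {F : Type*} [Field F] {n : ℕ} (a b : Fin n → F) :
    Matrix (Fin n ⊕ Fin n) (Pos n) F :=
  Matrix.fromCols (Matrix.fromBlocks 1 0 0 1)
    (Matrix.fromBlocks (circ a) (circ b) (-(circ b)ᵀ) (circ a)ᵀ)

/-- A linear code of length `4n` is four circulant if it is the row space of such a matrix. -/
def IsFourCirculant {F : Type*} [Field F] {n : ℕ} (C : Submodule F (Pos n → F)) : Prop :=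
  ∃ a b : Fin n → F, C = Submodule.span F (Set.range (generator a b).row)

/-- `C` equals its dual for the standard (Euclidean) inner product. -/
def IsSelfDual {F : Type*} [Field F] {ι : Type*} [Fintype ι] (C : Submodule F (ι → F)) : Prop :=
  ∀ v : ι → F, v ∈ C ↔ ∀ c ∈ C, v ⬝ᵥ c = 0

/-- The minimum Hamming distance between distinct codewords. -/
noncomputable def minDist {F : Type*} [Field F] [DecidableEq F] {ι : Type*} [Fintype ι]
    (C : Submodule F (ι → F)) : ℕ :=
  sInf {d | ∃ x ∈ C, ∃ y ∈ C, x ≠ y ∧ hammingDist x y = d}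

/-- `q` is a primitive root modulo `n`: its class generates the group of units of `ℤ / n`. -/
def IsPrimitiveRootMod (q n : ℕ) : Prop :=
  orderOf (q : ZMod n) = Nat.totient n

/-- The `q`-ary entropy function (to be used for `0 ≤ t ≤ (q - 1) / q`). -/
noncomputable def qEntropy (q : ℕ) (t : ℝ) : ℝ :=
  if t = 0 then 0
  else t * Real.logb q (q - 1) - t * Real.logb q t - (1 - t) * Real.logb q (1 - t)

/-- For `q ≥ 2` this is Mathlib's `q`-ary entropy, rescaled to logarithms in base `q`. -/
theorem qEntropy_eq (q : ℕ) (t : ℝ) : qEntropy q t = Real.qaryEntropy q t / Real.log q := by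
  unfold qEntropy Real.qaryEntropy
  split_ifs with h
  · simp [h]
  · simp only [Real.binEntropy, Real.log_inv, Real.logb]
    push_cast
    ring

end FourCirculant

/-!
The proof is a counting argument of Gilbert–Varshamov type inside a family of self-dual codes.

Let `n = 2 m + 1` be one of the primes and `Q = q ^ m`. Since `q` is a primitive root modulo `n`,
the cyclotomic polynomial `Φₙ` is irreducible over `F`, so `F[X] / (X ^ n - 1)` is `F × L` with
`L = F[X] / (Φₙ)` a field of `Q²` elements. A circulant matrix acts on the vector `(ζ ^ j)` of
powers of the root `ζ` of `Φₙ` as multiplication by the value of its first row at `ζ`, and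
transposition becomes the involution `σ : x ↦ x ^ Q` of `L`, because `q ^ m ≡ -1` modulo `n`
(`sum_circ_smul`, `sum_circ_transpose_smul`). Hence the code of `a`, `b` is self-dual once
`α σ(α) + β σ(β) = -1` for the values `α`, `β` of `a`, `b` at `ζ`, and `s² + t² = -1` for
their values `s`, `t` at `1` (`circ_mul_transpose_add`).

Fix `s` and `t`. The pairs `(α, β)` form the unit sphere of a Hermitian plane, with at least
`Q (Q² - 1)` points (`le_card_hermitian_sphere`). That a word `(u, v, w, z)` lies in the code of
`(α, β)` is a pair of linear equations in `(α, β)`, with at most `Q` solutions on the sphere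
(`card_hermitian_line_le`), unless `u` and `v` vanish at `ζ`; then all four blocks are constant,
so that the word is zero or has weight at least `n`. Therefore any set of fewer than `Q² - 1`
nonzero words of weight less than `n` is avoided by one of the codes (`exists_selfDual_avoiding`).

Let `c < 1 / 4` with `H_q(c) = 1 / 8`. The Hamming ball of radius `4 n c` has at most
`q ^ (4 n H_q(c)) = q ^ (n / 2)` elements (`card_hammingBall_le`), fewer than `Q² = q ^ (n - 1)`,
so there is a self-dual code of minimum distance greater than `4 n c`. The limit inferior `δ` of
the relative distances is thus at least `c`. It is at most `1 / 2`, as rows of the generator matrix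
have weight at most `2 n + 1`. Since `H_q` increases on `[0, 1 - 1 / q]`, the claim follows.
-/

namespace FourCirculant

/-! ### Self-dual codes with a systematic generator matrix -/

section SelfDual

variable {F : Type*} [Field F]

theorem mem_span_row_fromCols_one {ι : Type*} [Fintype ι] [DecidableEq ι] (M : Matrix ι ι F)
    (x : ι ⊕ ι → F) :
    x ∈ Submodule.span F (Set.range (fromCols 1 M).row) ↔
      x ∘ Sum.inr = (x ∘ Sum.inl) ᵥ* M := by
  rw [← range_vecMulLinear, LinearMap.mem_range]
  constructor
  · rintro ⟨y, rfl⟩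
    simp [vecMul_fromCols]
  · intro h
    refine ⟨x ∘ Sum.inl, ?_⟩
    rw [vecMulLinear_apply, vecMul_fromCols, vecMul_one, ← h]
    simp

theorem isSelfDual_span_row_fromCols_one {ι : Type*} [Fintype ι] [DecidableEq ι]
    (M : Matrix ι ι F) (hM : M * Mᵀ = -1) :
    IsSelfDual (Submodule.span F (Set.range (fromCols (1 : Matrix ι ι F) M).row)) := by
  have hM' : Mᵀ * M = -1 := by
    have h : M * (-Mᵀ) = (1 : Matrix ι ι F) := by rw [Matrix.mul_neg, hM, neg_neg]
    rw [← neg_eq_iff_eq_neg, ← Matrix.neg_mul, mul_eq_one_comm.mp h]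
  intro v
  have hdot : ∀ x : ι ⊕ ι → F, v ⬝ᵥ x =
      (v ∘ Sum.inl) ⬝ᵥ (x ∘ Sum.inl) + (v ∘ Sum.inr) ⬝ᵥ (x ∘ Sum.inr) := by
    intro x; simp [dotProduct, Fintype.sum_sum_type]
  constructor
  · intro hv c hc
    rw [mem_span_row_fromCols_one] at hv hc
    rw [hdot, hv, hc, ← Matrix.dotProduct_mulVec, ← mulVec_transpose M (c ∘ Sum.inl),
      mulVec_mulVec, hM]
    simp [Matrix.neg_mulVec]
  · intro h
    rw [mem_span_row_fromCols_one]
    -- testing against all rows gives `v.inl = -M *ᵥ v.inr`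
    have key : v ∘ Sum.inl = -(M *ᵥ (v ∘ Sum.inr)) := by
      refine dotProduct_eq _ _ fun y => ?_
      have := h (Sum.elim y (y ᵥ* M)) (by rw [mem_span_row_fromCols_one]; simp)
      rw [hdot] at this
      simp only [Sum.elim_comp_inl, Sum.elim_comp_inr] at this
      rw [eq_neg_of_add_eq_zero_left this, neg_dotProduct, dotProduct_comm,
        ← Matrix.dotProduct_mulVec, dotProduct_comm]
    rw [key, ← mulVec_transpose, Matrix.mulVec_neg, mulVec_mulVec, hM']
    simp [Matrix.neg_mulVec]

end SelfDual

/-! ### Circulant matrices and their eigenvectors -/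

section Circulant

variable {F : Type*} [Field F] {n : ℕ}

theorem circ_eq_transpose_circulant {R : Type*} {n : ℕ} (a : Fin n → R) : circ a = (circulant a)ᵀ := rfl

theorem circ_mul_comm [NeZero n] (a b : Fin n → F) : circ a * circ b = circ b * circ a := by
  simp only [circ_eq_transpose_circulant, ← transpose_mul]
  rw [Matrix.circulant_mul_comm]

theorem circ_mul_transpose_comm [NeZero n] (a : Fin n → F) :
    circ a * (circ a)ᵀ = (circ a)ᵀ * circ a := by
  rw [circ_eq_transpose_circulant, transpose_transpose, Matrix.transpose_circulant,
    Matrix.circulant_mul_comm]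

/-- The right half of the generator matrix of a four circulant code. -/
def rightHalf (a b : Fin n → F) : Matrix (Fin n ⊕ Fin n) (Fin n ⊕ Fin n) F :=
  fromBlocks (circ a) (circ b) (-(circ b)ᵀ) (circ a)ᵀ

theorem generator_eq (a b : Fin n → F) : generator a b = fromCols 1 (rightHalf a b) := by
  rw [generator, rightHalf, fromBlocks_one]

theorem rightHalf_mul_transpose [NeZero n] (a b : Fin n → F)
    (h : circ a * (circ a)ᵀ + circ b * (circ b)ᵀ = -1) :
    rightHalf a b * (rightHalf a b)ᵀ = -1 := by
  have h' := h
  rw [circ_mul_transpose_comm a, circ_mul_transpose_comm b] at h'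
  have h1 : (circ a)ᵀ * (circ b)ᵀ = (circ b)ᵀ * (circ a)ᵀ := by
    rw [← transpose_mul, ← transpose_mul, circ_mul_comm]
  rw [rightHalf, fromBlocks_transpose, fromBlocks_multiply, ← fromBlocks_one, fromBlocks_neg]
  congr 1
  · simp [circ_mul_comm a b]
  · simp [h1]
  · simpa [add_comm] using h'

variable {L : Type*} [Field L] [Algebra F L] (χ : Fin n → L)

/-- The polynomial `∑ j, a j X ^ j` evaluated at `ζ`, where `χ j = ζ ^ j`. -/
noncomputable abbrev evalAt : (Fin n → F) →ₗ[F] L := Fintype.linearCombination F χ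

variable {χ}

/-- A character `χ` of `ℤ / n` is an eigenvector of every circulant matrix. -/
theorem sum_circ_smul [NeZero n] (hχ : ∀ i j, χ (i + j) = χ i * χ j) (a : Fin n → F) (i : Fin n) :
    ∑ j, circ a i j • χ j = χ i * evalAt χ a := by
  rw [evalAt, Fintype.linearCombination_apply, Finset.mul_sum,
    ← (Equiv.subRight i).sum_comp (fun k => χ i * a k • χ k)]
  refine Finset.sum_congr rfl fun j _ => ?_
  simp only [Equiv.subRight_apply, circ, of_apply, mul_smul_comm, ← hχ, add_sub_cancel]

/-- A character `χ` is also an eigenvector of the transpose, with the conjugate eigenvalue. -/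
theorem sum_circ_transpose_smul [NeZero n] (hχ : ∀ i j, χ (i + j) = χ i * χ j)
    {σ : L →ₐ[F] L} (hσ : ∀ j, σ (χ j) = χ (-j)) (a : Fin n → F) (i : Fin n) :
    ∑ j, (circ a)ᵀ i j • χ j = χ i * σ (evalAt χ a) := by
  rw [evalAt, Fintype.linearCombination_apply, map_sum, Finset.mul_sum,
    ← (Equiv.subLeft i).sum_comp (fun k => χ i * σ (a k • χ k))]
  refine Finset.sum_congr rfl fun j _ => ?_
  simp [circ, hσ, ← hχ]

/-- If `χ` is an eigenvector of the matrix `M`, then `evalAt χ` turns `ᵥ* M` into multiplication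
by the eigenvalue. -/
theorem evalAt_vecMul (M : Matrix (Fin n) (Fin n) F) (t : L)
    (hM : ∀ i, ∑ j, M i j • χ j = χ i * t) (u : Fin n → F) :
    evalAt χ (u ᵥ* M) = evalAt χ u * t := by
  simp only [evalAt, Fintype.linearCombination_apply, vecMul, dotProduct, Finset.sum_smul,
    Finset.sum_mul]
  rw [Finset.sum_comm]
  refine Finset.sum_congr rfl fun i _ => ?_
  rw [smul_mul_assoc, ← hM, Finset.smul_sum]
  simp [smul_smul]

theorem sum_smul_mul (M N : Matrix (Fin n) (Fin n) F) (s t : L)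
    (hM : ∀ i, ∑ j, M i j • χ j = χ i * s) (hN : ∀ i, ∑ j, N i j • χ j = χ i * t) (i : Fin n) :
    ∑ j, (M * N) i j • χ j = χ i * (s * t) := by
  have := evalAt_vecMul N t hN (M i)
  simp only [evalAt, Fintype.linearCombination_apply] at this
  rw [hM, mul_assoc] at this
  rw [← this]; rfl

theorem sum_circ [NeZero n] (a : Fin n → F) (i : Fin n) : ∑ j, circ a i j = ∑ j, a j :=
  (Equiv.subRight i).sum_comp a

theorem sum_circ_transpose [NeZero n] (a : Fin n → F) (i : Fin n) : ∑ j, (circ a)ᵀ i j = ∑ j, a j :=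
  (Equiv.subLeft i).sum_comp a

/-- A matrix whose rows are killed both by `χ` and by the all-one vector vanishes, as soon as only
constant vectors are killed by `χ`. Applied to `A Aᵀ + B Bᵀ + 1` this reduces the self-duality of
a four circulant code to one equation in `L` and one in `F`. -/
theorem circ_mul_transpose_add [NeZero n] (hχ : ∀ i j, χ (i + j) = χ i * χ j)
    {σ : L →ₐ[F] L} (hσ : ∀ j, σ (χ j) = χ (-j))
    (hker : ∀ a : Fin n → F, evalAt χ a = 0 → ∃ c, a = fun _ => c) (hn : (n : F) ≠ 0)
    (a b : Fin n → F)
    (hL : evalAt χ a * σ (evalAt χ a) + evalAt χ b * σ (evalAt χ b) = -1)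
    (hF : (∑ j, a j) ^ 2 + (∑ j, b j) ^ 2 = -1) :
    circ a * (circ a)ᵀ + circ b * (circ b)ᵀ = -1 := by
  rw [← sub_eq_zero, sub_neg_eq_add]
  have hrow : ∀ (a : Fin n → F) i, ∑ j, (circ a * (circ a)ᵀ) i j = (∑ j, a j) ^ 2 := by
    intro a i
    simp only [mul_apply]
    rw [Finset.sum_comm]
    simp only [← Finset.mul_sum, sum_circ_transpose, ← Finset.sum_mul, sum_circ, sq]
  have hone : ∀ i, ∑ j, (1 : Matrix (Fin n) (Fin n) F) i j • χ j = χ i := by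
    intro i
    simp [one_apply]
  have hadd : ∀ i j, (circ a * (circ a)ᵀ + circ b * (circ b)ᵀ + 1) i j =
      (circ a * (circ a)ᵀ) i j + (circ b * (circ b)ᵀ) i j + (1 : Matrix (Fin n) (Fin n) F) i j :=
    fun _ _ => rfl
  ext i j
  obtain ⟨c, hc⟩ := hker (fun j => (circ a * (circ a)ᵀ + circ b * (circ b)ᵀ + 1) i j) (by
    have ha := sum_smul_mul _ _ _ _ (sum_circ_smul hχ a) (sum_circ_transpose_smul hχ hσ a) i
    have hb := sum_smul_mul _ _ _ _ (sum_circ_smul hχ b) (sum_circ_transpose_smul hχ hσ b) i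
    rw [evalAt, Fintype.linearCombination_apply]
    simp only [hadd, add_smul, Finset.sum_add_distrib, ha, hb, hone]
    rw [← mul_add, hL]
    ring)
  have hs : ∑ j, (circ a * (circ a)ᵀ + circ b * (circ b)ᵀ + 1) i j = 0 := by
    simp only [hadd, Finset.sum_add_distrib, hrow, hF]
    simp [one_apply]
  have hc' : ∀ j, (circ a * (circ a)ᵀ + circ b * (circ b)ᵀ + 1) i j = c := congrFun hc
  simp only [hc'] at hs ⊢
  simpa [hn] using hs

end Circulant

/-! ### Counting solutions of Hermitian equations -/

section Hermitian

variable {L : Type*} [Field L] [DecidableEq L] {Q : ℕ}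

/-- The norm `x ↦ x ^ (Q + 1)` of `𝔽_{Q²}` over `𝔽_Q` takes every nonzero value `Q + 1` times. -/
theorem card_pow_succ_eq [Fintype L] (hQ : 2 ≤ Q) (hL : Fintype.card L = Q ^ 2) {γ : L} (hγ : γ ≠ 0)
    (hγQ : γ ^ Q = γ) : (Finset.univ.filter fun x : L => x ^ (Q + 1) = γ).card = Q + 1 := by
  obtain ⟨g, hg⟩ := IsCyclic.exists_generator (α := Lˣ)
  have hfac : Fintype.card L - 1 = (Q - 1) * (Q + 1) := by
    obtain ⟨k, rfl⟩ : ∃ k, Q = k + 1 := ⟨Q - 1, by omega⟩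
    rw [hL, show (k + 1) ^ 2 = k * (k + 1 + 1) + 1 by ring]
    simp
  have hord : orderOf g = (Q - 1) * (Q + 1) := by
    rw [orderOf_eq_card_of_forall_mem_zpowers hg, Nat.card_eq_fintype_card, Fintype.card_units,
      hfac]
  have hpos : 0 < (Q - 1) * (Q + 1) := Nat.mul_pos (by omega) (by omega)
  have hprim : IsPrimitiveRoot ((g : L) ^ (Q - 1)) (Q + 1) := by
    have h := IsPrimitiveRoot.orderOf g
    rw [hord] at h
    exact (IsPrimitiveRoot.coe_units_iff.mpr h).pow hpos rfl
  have hex : ∃ x : L, x ^ (Q + 1) = γ := by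
    obtain ⟨k, hk⟩ := (Submonoid.mem_powers_iff _ _).mp
      (mem_powers_iff_mem_zpowers.mpr (hg (Units.mk0 γ hγ)))
    have h1 : (Units.mk0 γ hγ) ^ (Q - 1) = 1 := by
      ext
      have : γ * γ ^ (Q - 1) = γ * 1 := by
        rw [← pow_succ', Nat.sub_add_cancel (by omega), hγQ, mul_one]
      simpa using mul_left_cancel₀ hγ this
    rw [← hk, ← pow_mul] at h1
    have h2 := orderOf_dvd_of_pow_eq_one h1
    rw [hord, mul_comm k] at h2
    obtain ⟨l, rfl⟩ := Nat.dvd_of_mul_dvd_mul_left (by omega) h2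
    refine ⟨(g : L) ^ l, ?_⟩
    have := congrArg (Units.val) hk
    rw [← pow_mul, mul_comm l]
    simpa using this
  have hcard := hprim.card_nthRoots γ
  rw [if_pos hex, ← Multiset.toFinset_card_of_nodup (hprim.nthRoots_nodup hγ)] at hcard
  refine Eq.trans (congrArg Finset.card ?_) hcard
  ext x
  simp [Polynomial.mem_nthRoots]

/-- The unit sphere of the Hermitian plane over `𝔽_{Q²}` has at least `Q (Q² - 1)` points. -/
theorem le_card_hermitian_sphere [Fintype L] (hQ : 2 ≤ Q) (hL : Fintype.card L = Q ^ 2)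
    (hneg : (-1 : L) ^ Q = -1) (hadd : ∀ x y : L, (x + y) ^ Q = x ^ Q + y ^ Q) :
    Q * (Q ^ 2 - 1) ≤
      (Finset.univ.filter fun p : L × L => p.1 ^ (Q + 1) + p.2 ^ (Q + 1) = -1).card := by
  have hQQ : ∀ x : L, (x ^ Q) ^ Q = x := fun x => by
    rw [← pow_mul, ← sq, ← hL, FiniteField.pow_card]
  have hfib : ∀ y : L, (Q + 1) - (if y ^ (Q + 1) = -1 then Q else 0) ≤
      (Finset.univ.filter fun x : L => x ^ (Q + 1) + y ^ (Q + 1) = -1).card := by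
    intro y
    split_ifs with h
    · rw [Nat.add_sub_cancel_left, Nat.one_le_iff_ne_zero, Finset.card_ne_zero]
      exact ⟨0, by simp [h]⟩
    · refine (card_pow_succ_eq (γ := -1 - y ^ (Q + 1)) hQ hL ?_ ?_).ge.trans
        (Finset.card_le_card fun x => ?_)
      · exact fun h' => h (sub_eq_zero.mp h').symm
      · have h1 : (y ^ (Q + 1)) ^ Q = y ^ (Q + 1) := by
          rw [pow_succ, mul_pow, hQQ, mul_comm]
        have h2 := hadd (-1 - y ^ (Q + 1)) (y ^ (Q + 1))
        rw [sub_add_cancel, hneg, h1] at h2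
        exact eq_sub_of_add_eq h2.symm
      · simp only [Finset.mem_filter, Finset.mem_univ, true_and]
        intro hx
        rw [hx]; ring
  have hiso : (Finset.univ.filter fun y : L => y ^ (Q + 1) = -1).card ≤ Q + 1 := by
    rw [card_pow_succ_eq hQ hL (neg_ne_zero.mpr one_ne_zero) hneg]
  calc Q * (Q ^ 2 - 1) ≤ ∑ y : L, ((Q + 1) - (if y ^ (Q + 1) = -1 then Q else 0)) := by
        have : ∑ y : L, ((Q + 1) - (if y ^ (Q + 1) = -1 then Q else 0)) +
            ∑ y : L, (if y ^ (Q + 1) = -1 then Q else 0) = ∑ y : L, (Q + 1) := by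
          rw [← Finset.sum_add_distrib]
          refine Finset.sum_congr rfl fun y _ => Nat.sub_add_cancel ?_
          split_ifs <;> omega
        rw [← Finset.sum_filter] at this
        simp only [Finset.sum_const, Finset.card_univ, hL, smul_eq_mul] at this
        have h3 := Nat.mul_le_mul_right Q hiso
        have h4 : Q * (Q ^ 2 - 1) + Q = Q ^ 3 := by
          obtain ⟨k, hk⟩ : ∃ k, Q ^ 2 = k + 1 :=
            ⟨Q ^ 2 - 1, by have : 0 < Q ^ 2 := by positivity
                           omega⟩
          rw [pow_succ Q 2, hk, Nat.add_sub_cancel]; ring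
        nlinarith
    _ ≤ ∑ y : L, (Finset.univ.filter fun x : L => x ^ (Q + 1) + y ^ (Q + 1) = -1).card :=
        Finset.sum_le_sum fun y _ => hfib y
    _ = _ := by
        simp only [Finset.card_filter]
        rw [Fintype.sum_prod_type_right]

/-- For fixed `(U, V) ≠ 0` the two linear conditions have at most `Q` solutions on the Hermitian
sphere. If `(U, V)` is anisotropic they determine `(α, β)`; otherwise they cut out an affine
line, on which the equation of the sphere becomes a polynomial of degree `Q` in `β`. -/
theorem card_hermitian_line_le (hQ : 2 ≤ Q) (σ : L →+* L) (hσ : ∀ x, σ x = x ^ Q)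
    (hσσ : ∀ x, σ (σ x) = x) {U V : L} (hUV : U ≠ 0 ∨ V ≠ 0) (W Z : L) (S : Finset (L × L))
    (hS : ∀ p ∈ S, p.1 * σ p.1 + p.2 * σ p.2 = -1 ∧
      W = U * p.1 - V * σ p.2 ∧ Z = U * p.2 + V * σ p.1) : S.card ≤ Q := by
  rcases S.eq_empty_or_nonempty with rfl | ⟨p₀, hp₀⟩
  · simp
  by_cases hD : U * σ U + V * σ V = 0
  · have hU : U ≠ 0 := by
      rintro rfl
      simp_all
    have hV : V ≠ 0 := by
      rintro rfl
      simp_all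
    have hinj : Set.InjOn Prod.snd (S : Set (L × L)) := by
      rintro ⟨α, β⟩ h1 ⟨α', β'⟩ h2 (rfl : β = β')
      have e1 := (hS _ h1).2.1
      have e2 := (hS _ h2).2.1
      simp only at e1 e2
      have : U * α = U * α' := by linear_combination e2 - e1
      rw [mul_left_cancel₀ hU this]
    rw [← Finset.card_image_of_injOn hinj]
    have hβ : ∀ p ∈ S, V * σ W * σ p.2 + W * σ V * p.2 + (W * σ W + U * σ U) = 0 := by
      intro p hp
      obtain ⟨h1, h2, -⟩ := hS p hp
      have h3 : U * p.1 = W + V * σ p.2 := by rw [h2]; ring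
      have h4 : σ U * σ p.1 = σ W + σ V * p.2 := by
        rw [← map_mul, h3, map_add, map_mul, hσσ]
      linear_combination (U * σ U) * h1 - (σ U * σ p.1) * h3 - (W + V * σ p.2) * h4 -
        p.2 * σ p.2 * hD
    have hW : W ≠ 0 := by
      rintro rfl
      have := hβ p₀ hp₀
      simp [hU] at this
    let P : Polynomial L := Polynomial.C (V * σ W) * Polynomial.X ^ Q +
      (Polynomial.C (W * σ V) * Polynomial.X + Polynomial.C (W * σ W + U * σ U))
    have hlow : (Polynomial.C (W * σ V) * Polynomial.X +
        Polynomial.C (W * σ W + U * σ U)).degree < (Q : WithBot ℕ) :=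
      Polynomial.degree_linear_le.trans_lt (by exact_mod_cast hQ)
    have hVW : V * σ W ≠ 0 := by simp [hV, hW]
    have hdeg : P.degree = Q := by
      rw [Polynomial.degree_add_eq_left_of_degree_lt] <;>
        rw [Polynomial.degree_C_mul_X_pow _ hVW]
      exact hlow
    have hP0 : P ≠ 0 := by
      rintro h
      rw [h] at hdeg
      simp at hdeg
    calc (S.image Prod.snd).card ≤ P.roots.toFinset.card := by
          refine Finset.card_le_card fun β hβS => ?_
          obtain ⟨p, hp, rfl⟩ := Finset.mem_image.mp hβS
          rw [Multiset.mem_toFinset, Polynomial.mem_roots hP0, Polynomial.IsRoot, ← hβ p hp]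
          simp [P, hσ]
          ring
      _ ≤ Multiset.card P.roots := Multiset.toFinset_card_le _
      _ ≤ P.natDegree := P.card_roots'
      _ = Q := Polynomial.natDegree_eq_of_degree_eq_some hdeg
  · refine le_trans (Finset.card_le_one.mpr ?_) (by omega : 1 ≤ Q)
    rintro ⟨α, β⟩ h1 ⟨α', β'⟩ h2
    obtain ⟨-, e1, f1⟩ := hS _ h1
    obtain ⟨-, e2, f2⟩ := hS _ h2
    simp only at e1 e2 f1 f2
    have a1 : U * (α - α') = V * σ (β - β') := by rw [map_sub]; linear_combination e2 - e1
    have a2 : U * (β - β') = -(V * σ (α - α')) := by rw [map_sub]; linear_combination f2 - f1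
    have b1 : σ U * σ (α - α') = σ V * (β - β') := by
      rw [← map_mul, a1, map_mul, hσσ]
    have b2 : σ U * σ (β - β') = -(σ V * (α - α')) := by
      rw [← map_mul, a2, map_neg, map_mul, hσσ]
    have c1 : (U * σ U + V * σ V) * (α - α') = 0 := by linear_combination σ U * a1 + V * b2
    have c2 : (U * σ U + V * σ V) * (β - β') = 0 := by linear_combination σ U * a2 - V * b1
    rw [Prod.mk.injEq]
    exact ⟨sub_eq_zero.mp ((mul_eq_zero.mp c1).resolve_left hD),
      sub_eq_zero.mp ((mul_eq_zero.mp c2).resolve_left hD)⟩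

end Hermitian

/-! ### The cyclotomic field -/

section Cyclotomic

universe u

variable {F : Type u} [Field F] {n : ℕ}

/-- If `q = |F|` is a primitive root modulo `n`, the `n`-th cyclotomic polynomial is
irreducible over `F`. -/
theorem irreducible_cyclotomic [Fintype F] (hcop : Nat.gcd n (Fintype.card F) = 1)
    (hroot : IsPrimitiveRootMod (Fintype.card F) n) :
    Irreducible (Polynomial.cyclotomic n F) := by
  obtain ⟨f, hp, hf⟩ := FiniteField.card F (ringChar F)
  have : Fact (ringChar F).Prime := ⟨hp⟩
  have hpn : (ringChar F).Coprime n := by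
    rw [hf] at hcop
    exact (Nat.Coprime.coprime_dvd_right (dvd_pow_self _ f.2.ne') hcop).symm
  refine Polynomial.irreducible_of_dvd_cyclotomic_of_natDegree hf hpn dvd_rfl ?_
  rw [Polynomial.natDegree_cyclotomic, ← hroot, ← orderOf_units, ZMod.coe_unitOfCoprime, hf]

/-- If `q ^ (2 m) ≡ 1` is the first power of `q` congruent to `1` modulo the prime `2 m + 1`, then
`q ^ m ≡ -1`. -/
theorem pow_half_eq_neg_one {m q : ℕ} (hn : n.Prime) (hm : n = 2 * m + 1) (hm0 : 0 < m)
    (hroot : IsPrimitiveRootMod q n) : (q : ZMod n) ^ m = -1 := by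
  have : Fact n.Prime := ⟨hn⟩
  have hord : orderOf (q : ZMod n) = 2 * m := by
    rw [hroot, Nat.totient_prime hn, hm]; rfl
  have h1 : ((q : ZMod n) ^ m) ^ 2 = 1 := by
    rw [← pow_mul, mul_comm m, ← hord, pow_orderOf_eq_one]
  refine (mul_self_eq_one_iff.mp ((sq _).symm.trans h1)).resolve_left fun h => ?_
  have := Nat.le_of_dvd hm0 (hord ▸ orderOf_dvd_of_pow_eq_one h)
  omega

/-- The data used of the quadratic extension: a field `L` with `Q²` elements, the additive
character `j ↦ ζ ^ j` of `ℤ / n` for a primitive `n`-th root of unity `ζ` generating `L`, and the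
involution `σ : x ↦ x ^ Q` with `σ ζ = ζ⁻¹`. -/
structure CyclotomicData (F : Type*) [Field F] (n : ℕ) [NeZero n] (L : Type*) [Field L]
    [Fintype L] [Algebra F L] where
  /-- the square root of the cardinality of `L` -/
  Q : ℕ
  /-- the involution of `L` -/
  σ : L →ₐ[F] L
  /-- the powers of the root of unity -/
  χ : Fin n → L
  two_le : 2 ≤ Q
  card_eq : Fintype.card L = Q ^ 2
  finrank_eq : Module.finrank F L + 1 = n
  σ_apply : ∀ x, σ x = x ^ Q
  χ_add : ∀ i j, χ (i + j) = χ i * χ j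
  σ_χ : ∀ j, σ (χ j) = χ (-j)
  eq_const : ∀ a : Fin n → F, evalAt χ a = 0 → ∃ c, a = fun _ => c

/-- For prime `n` the multiples of `Φₙ = 1 + X + ⋯ + X ^ (n - 1)` of degree less than `n` are its
scalar multiples. -/
theorem exists_const_of_cyclotomic_dvd (hn : n.Prime) (a : Fin n → F)
    (h : Polynomial.cyclotomic n F ∣ ∑ j : Fin n, Polynomial.C (a j) * Polynomial.X ^ (j : ℕ)) :
    ∃ c, a = fun _ => c := by
  have : Fact n.Prime := ⟨hn⟩
  obtain ⟨g, hg⟩ := h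
  have hcoeff : ∀ j : Fin n, (∑ j : Fin n,
      Polynomial.C (a j) * Polynomial.X ^ (j : ℕ)).coeff j = a j := by
    intro j
    simp [Polynomial.finsetSum_coeff, Polynomial.coeff_X_pow, Fin.val_inj]
  have hdeg : (∑ j : Fin n, Polynomial.C (a j) * Polynomial.X ^ (j : ℕ)).degree < (n : WithBot ℕ) := by
    refine (Polynomial.degree_sum_le _ _).trans_lt ?_
    rw [Finset.sup_lt_iff (WithBot.bot_lt_coe _)]
    intro j _
    exact (Polynomial.degree_C_mul_X_pow_le _ _).trans_lt (by exact_mod_cast j.2)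
  by_cases hg0 : g = 0
  · refine ⟨0, funext fun j => ?_⟩
    rw [← hcoeff, hg, hg0]; simp
  have hgd : g.natDegree = 0 := by
    rw [hg, Polynomial.degree_mul, Polynomial.degree_cyclotomic, Polynomial.degree_eq_natDegree hg0,
      Nat.totient_prime hn] at hdeg
    have : n - 1 + g.natDegree < n := by exact_mod_cast hdeg
    omega
  refine ⟨g.coeff 0, funext fun j => ?_⟩
  rw [← hcoeff, hg, Polynomial.eq_C_of_natDegree_eq_zero hgd, Polynomial.coeff_mul_C,
    Polynomial.cyclotomic_prime]
  simp [Polynomial.finsetSum_coeff, Polynomial.coeff_X_pow]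

theorem exists_cyclotomicData [Fintype F] {m : ℕ} [NeZero n] (hn : n.Prime)
    (hm : n = 2 * m + 1) (hm0 : 0 < m) (hcop : Nat.gcd n (Fintype.card F) = 1)
    (hroot : IsPrimitiveRootMod (Fintype.card F) n) :
    ∃ (L : Type u) (_ : Field L) (_ : Fintype L) (_ : Algebra F L) (D : CyclotomicData F n L),
      D.Q = Fintype.card F ^ m := by
  have hirr := irreducible_cyclotomic hcop hroot
  have : Fact n.Prime := ⟨hn⟩
  have : Fact (Irreducible (Polynomial.cyclotomic n F)) := ⟨hirr⟩
  have hmonic := Polynomial.cyclotomic.monic n F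
  have := hmonic.finite_adjoinRoot
  have : Finite (AdjoinRoot (Polynomial.cyclotomic n F)) := Module.finite_of_finite F
  let := Fintype.ofFinite (AdjoinRoot (Polynomial.cyclotomic n F))
  have hrank : Module.finrank F (AdjoinRoot (Polynomial.cyclotomic n F)) = 2 * m := by
    rw [(AdjoinRoot.powerBasis' hmonic).finrank, AdjoinRoot.powerBasis'_dim,
      Polynomial.natDegree_cyclotomic, Nat.totient_prime hn, hm]; rfl
  have hcard : Fintype.card (AdjoinRoot (Polynomial.cyclotomic n F)) =
      (Fintype.card F ^ m) ^ 2 := by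
    rw [Module.card_eq_pow_finrank (K := F), hrank, ← pow_mul, mul_comm]
  have hζ : AdjoinRoot.root (Polynomial.cyclotomic n F) ^ n = 1 := by
    have h := AdjoinRoot.mk_eq_zero.mpr (Polynomial.cyclotomic.dvd_X_pow_sub_one n F)
    rw [map_sub, map_pow, AdjoinRoot.mk_X, map_one] at h
    exact sub_eq_zero.mp h
  have hper : ∀ k l : ℕ, k ≡ l [MOD n] → AdjoinRoot.root (Polynomial.cyclotomic n F) ^ k =
      AdjoinRoot.root (Polynomial.cyclotomic n F) ^ l := by
    intro k l hkl
    rw [pow_eq_pow_mod k hζ, pow_eq_pow_mod l hζ, hkl]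
  have hσ : ∀ x : AdjoinRoot (Polynomial.cyclotomic n F),
      ((FiniteField.frobeniusAlgHom F (AdjoinRoot (Polynomial.cyclotomic n F))) ^ m) x =
        x ^ Fintype.card F ^ m := by
    intro x
    rw [AlgHom.coe_pow, FiniteField.coe_frobeniusAlgHom, pow_iterate]
  refine ⟨AdjoinRoot (Polynomial.cyclotomic n F), inferInstance, inferInstance, inferInstance,
    { Q := Fintype.card F ^ m
      σ := FiniteField.frobeniusAlgHom F (AdjoinRoot (Polynomial.cyclotomic n F)) ^ m
      χ := fun j => AdjoinRoot.root (Polynomial.cyclotomic n F) ^ (j : ℕ)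
      two_le := Fintype.one_lt_card.trans_le (Nat.le_self_pow hm0.ne' _)
      card_eq := hcard
      finrank_eq := by rw [hrank, hm]
      σ_apply := hσ
      χ_add := ?_
      σ_χ := ?_
      eq_const := ?_ }, rfl⟩
  · intro i j
    rw [← pow_add]
    apply hper
    rw [Fin.val_add]
    exact Nat.mod_modEq _ _
  · intro j
    rw [hσ, ← pow_mul]
    apply hper
    rw [← ZMod.natCast_eq_natCast_iff]
    push_cast
    rw [pow_half_eq_neg_one hn hm hm0 hroot, mul_neg_one, eq_comm, ← add_eq_zero_iff_eq_neg,
      ← Nat.cast_add, ZMod.natCast_eq_zero_iff, Nat.dvd_iff_mod_eq_zero, ← Fin.val_add]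
    simp
  · intro a ha
    refine exists_const_of_cyclotomic_dvd hn a (AdjoinRoot.mk_eq_zero.mp ?_)
    rw [← ha, evalAt, Fintype.linearCombination_apply, map_sum]
    refine Finset.sum_congr rfl fun j _ => ?_
    rw [map_mul, map_pow, AdjoinRoot.mk_X, AdjoinRoot.mk_C, Algebra.smul_def]
    rfl

end Cyclotomic

/-! ### Hamming balls and the entropy function -/

section Entropy

/-- The entropy bound for the volume of a Hamming ball of relative radius `c`. If the coordinates
are drawn independently, being `0` with probability `1 - c` and each other symbol with
probability `c / (q - 1)`, then every word of the ball has probability at least `exp (-N H(c))`. -/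
theorem card_hammingBall_le {F ι : Type*} [Field F] [Fintype F] [DecidableEq F] [Fintype ι]
    [DecidableEq ι] {c : ℝ} (hc : 0 < c) (hcq : c ≤ 1 - 1 / (Fintype.card F : ℝ)) :
    ((Finset.univ.filter fun x : ι → F =>
      (hammingNorm x : ℝ) ≤ c * Fintype.card ι).card : ℝ) ≤
      Real.exp (Fintype.card ι * Real.qaryEntropy (Fintype.card F) c) := by
  have hq : (2 : ℝ) ≤ Fintype.card F := by exact_mod_cast Fintype.one_lt_card (α := F)
  set q : ℝ := (Fintype.card F : ℝ) with hqdef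
  have hc1 : 0 < 1 - c := by
    have : 0 < 1 / q := by positivity
    linarith
  have hcq' : 0 < c / (q - 1) := div_pos hc (by linarith)
  let l : F → ℝ := fun y => if y = 0 then Real.log (1 - c) else Real.log (c / (q - 1))
  have hsum : ∑ y, Real.exp (l y) = 1 := by
    have : ∀ y, Real.exp (l y) = if y = 0 then 1 - c else c / (q - 1) := by
      intro y
      simp only [l]
      split_ifs
      · exact Real.exp_log hc1
      · exact Real.exp_log hcq'
    simp only [this]
    rw [Finset.sum_ite, Finset.sum_const, Finset.sum_const, Finset.filter_eq' Finset.univ (0 : F),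
      Finset.filter_ne' Finset.univ (0 : F), Finset.card_erase_of_mem (Finset.mem_univ _),
      Finset.card_univ]
    simp only [Finset.mem_univ, if_true, Finset.card_singleton, nsmul_eq_mul]
    rw [Nat.cast_sub Fintype.card_pos, ← hqdef]
    have : q - 1 ≠ 0 := by linarith
    rw [Nat.cast_one]
    field_simp
    ring
  have htotal : ∑ x : ι → F, Real.exp (∑ i, l (x i)) = 1 := by
    have h := Finset.prod_univ_sum (fun _ : ι => (Finset.univ : Finset F))
      (fun _ y => Real.exp (l y))
    simp only [hsum, Finset.prod_const_one, Fintype.piFinset_univ] at h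
    simp only [Real.exp_sum, ← h]
  set D : ℝ := Real.log (c / (q - 1)) - Real.log (1 - c) with hD
  have hD0 : D ≤ 0 := by
    rw [hD, sub_nonpos]
    refine Real.log_le_log hcq' ?_
    rw [div_le_iff₀ (by linarith)]
    have h1 : c * q ≤ q - 1 := by
      calc c * q ≤ (1 - 1 / q) * q := by gcongr
        _ = q - 1 := by field_simp
    nlinarith
  have hl : ∀ x : ι → F, ∑ i, l (x i) = Fintype.card ι * Real.log (1 - c) + hammingNorm x * D := by
    intro x
    have : ∀ i, l (x i) = Real.log (1 - c) + if x i ≠ 0 then D else 0 := by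
      intro i
      by_cases h : x i = 0 <;> simp [l, h, hD]
    simp only [this, Finset.sum_add_distrib, Finset.sum_const, ← Finset.sum_filter, nsmul_eq_mul,
      Finset.card_univ, hammingNorm]
  have hH : Real.log (1 - c) + c * D = -Real.qaryEntropy (Fintype.card F) c := by
    rw [hD, Real.qaryEntropy, Real.binEntropy, Real.log_div hc.ne' (by linarith), Real.log_inv,
      Real.log_inv]
    push_cast
    ring
  have hlow : ∀ x ∈ Finset.univ.filter fun x : ι → F => (hammingNorm x : ℝ) ≤ c * Fintype.card ι,
      Real.exp (-(Fintype.card ι * Real.qaryEntropy (Fintype.card F) c)) ≤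
        Real.exp (∑ i, l (x i)) := by
    intro x hx
    rw [Real.exp_le_exp, hl, ← mul_neg, ← hH]
    have := mul_le_mul_of_nonpos_right (Finset.mem_filter.mp hx).2 hD0
    linarith
  have h1 := (Finset.card_nsmul_le_sum _ _ _ hlow).trans
    (Finset.sum_le_sum_of_subset_of_nonneg (Finset.subset_univ _)
      fun _ _ _ => (Real.exp_pos _).le)
  rw [htotal, nsmul_eq_mul, Real.exp_neg, ← div_eq_mul_inv, div_le_one (Real.exp_pos _)] at h1
  exact h1

/-- The value `1 / 8` of the entropy in base `q` is attained below `1 / 4`, because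
`H_q(1 / 4) ≥ 1 / 4`. -/
theorem exists_qaryEntropy_eq {q : ℕ} (hq : 2 ≤ q) :
    ∃ c : ℝ, 0 < c ∧ c < 1 / 4 ∧ Real.qaryEntropy q c = Real.log q / 8 := by
  have hq' : (2 : ℝ) ≤ q := by exact_mod_cast hq
  have hlog : 0 < Real.log q := Real.log_pos (by linarith)
  have h4 : Real.log q / 4 ≤ Real.qaryEntropy q (1 / 4) := by
    rw [Real.qaryEntropy, Real.binEntropy]
    push_cast
    have h1 : Real.log q ≤ Real.log (q - 1) + Real.log 4 := by
      rw [← Real.log_mul (by linarith) (by norm_num)]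
      exact Real.log_le_log (by linarith) (by linarith)
    have h2 : 0 ≤ Real.log (1 - 1 / 4 : ℝ)⁻¹ := Real.log_nonneg (by norm_num)
    have h3 : ((1 : ℝ) / 4)⁻¹ = 4 := by norm_num
    rw [h3]
    linarith
  obtain ⟨c, ⟨hc0, hc1⟩, hc⟩ := intermediate_value_Icc (by norm_num : (0 : ℝ) ≤ 1 / 4)
    (Real.qaryEntropy_continuous (q := q)).continuousOn
    (show Real.log q / 8 ∈ Set.Icc (Real.qaryEntropy q 0) (Real.qaryEntropy q (1 / 4)) from
      ⟨by rw [Real.qaryEntropy_zero]; linarith, by linarith⟩)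
  refine ⟨c, lt_of_le_of_ne hc0 ?_, lt_of_le_of_ne hc1 ?_, hc⟩
  · rintro rfl
    rw [Real.qaryEntropy_zero] at hc
    linarith
  · rintro rfl
    linarith

end Entropy

/-! ### Codes avoiding a small set of words -/

section Avoiding

variable {F : Type*} [Field F] {n : ℕ} [NeZero n] {L : Type*} [Field L] [Fintype L] [Algebra F L]

/-- The Chinese remainder theorem for `F[X] / (X ^ n - 1)`: a polynomial can be prescribed
at `ζ` and at `1`. -/
theorem CyclotomicData.exists_lift (D : CyclotomicData F n L) (hn : (n : F) ≠ 0) (α : L) (s : F) :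
    ∃ a : Fin n → F, evalAt D.χ a = α ∧ ∑ j, a j = s := by
  let T : (Fin n → F) →ₗ[F] L × F := (evalAt D.χ).prod (Fintype.linearCombination F fun _ => 1)
  have hT : ∀ a, T a = (evalAt D.χ a, ∑ j, a j) := by
    intro a
    simp [T, Fintype.linearCombination_apply]
  have hinj : Function.Injective T := by
    rw [← LinearMap.ker_eq_bot, LinearMap.ker_eq_bot']
    intro a ha
    rw [hT, Prod.mk_eq_zero] at ha
    obtain ⟨c, rfl⟩ := D.eq_const a ha.1
    have := ha.2
    simp only [Finset.sum_const, Finset.card_univ, Fintype.card_fin, nsmul_eq_mul, mul_eq_zero,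
      hn, false_or] at this
    rw [this]; rfl
  have hfin : Module.Finite F L := Module.Finite.of_finite
  have hsurj := (LinearMap.injective_iff_surjective_of_finrank_eq_finrank (f := T) (by
    rw [Module.finrank_prod, Module.finrank_self, D.finrank_eq, Module.finrank_fintype_fun_eq_card,
      Fintype.card_fin])).mp hinj
  obtain ⟨a, ha⟩ := hsurj (α, s)
  rw [hT, Prod.mk.injEq] at ha
  exact ⟨a, ha⟩

/-- Evaluating at `ζ` turns membership in the code of `a`, `b` into two linear equations for the
values of `a` and `b` at `ζ`. -/
theorem evalAt_of_mem_span_generator (D : CyclotomicData F n L) {a b : Fin n → F}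
    {x : Pos n → F} (hx : x ∈ Submodule.span F (Set.range (generator a b).row)) :
    evalAt D.χ (x ∘ Sum.inr ∘ Sum.inl) =
        evalAt D.χ (x ∘ Sum.inl ∘ Sum.inl) * evalAt D.χ a -
          evalAt D.χ (x ∘ Sum.inl ∘ Sum.inr) * D.σ (evalAt D.χ b) ∧
      evalAt D.χ (x ∘ Sum.inr ∘ Sum.inr) =
        evalAt D.χ (x ∘ Sum.inl ∘ Sum.inl) * evalAt D.χ b +
          evalAt D.χ (x ∘ Sum.inl ∘ Sum.inr) * D.σ (evalAt D.χ a) := by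
  rw [generator_eq, mem_span_row_fromCols_one, rightHalf, vecMul_fromBlocks] at hx
  have h1 : x ∘ Sum.inr ∘ Sum.inl = _ := congrArg (· ∘ Sum.inl) hx
  have h2 : x ∘ Sum.inr ∘ Sum.inr = _ := congrArg (· ∘ Sum.inr) hx
  simp only [Sum.elim_comp_inl, Sum.elim_comp_inr, vecMul_neg] at h1 h2
  rw [h1, h2, map_add, map_neg, map_add,
    evalAt_vecMul _ _ (sum_circ_smul D.χ_add a), evalAt_vecMul _ _ (sum_circ_smul D.χ_add b),
    evalAt_vecMul _ _ (sum_circ_transpose_smul D.χ_add D.σ_χ a),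
    evalAt_vecMul _ _ (sum_circ_transpose_smul D.χ_add D.σ_χ b), ← sub_eq_add_neg]
  exact ⟨rfl, rfl⟩

/-- A word of weight less than `n` that is constant on a block of length `n` vanishes there. -/
theorem comp_eq_zero_of_const {F ι : Type*} [Field F] [DecidableEq F] [Fintype ι] {n : ℕ}
    {x : ι → F} (hx : hammingNorm x < n) {e : Fin n → ι} (he : Function.Injective e) {c : F}
    (hc : x ∘ e = fun _ => c) : x ∘ e = 0 := by
  have hc' : ∀ j, x (e j) = c := congrFun hc
  by_cases h : c = 0
  · rw [hc, h]; rfl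
  · refine absurd hx (not_lt.mpr ?_)
    calc n = (Finset.univ.map ⟨e, he⟩).card := by simp
      _ ≤ hammingNorm x := by
        refine Finset.card_le_card fun i hi => ?_
        obtain ⟨j, -, rfl⟩ := Finset.mem_map.mp hi
        simp [hc', h]

/-- A set of fewer than `Q² - 1` nonzero words of weight less than `n` is avoided by some self-dual
four circulant code. The codes considered are those whose polynomials `a`, `b` take fixed values
at `1`; they are parametrized by the Hermitian sphere of `L`, and each word lies in at most `Q` of
them. -/
theorem exists_selfDual_avoiding [DecidableEq F] (D : CyclotomicData F n L) (hn : (n : F) ≠ 0)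
    {s t : F} (hst : s ^ 2 + t ^ 2 = -1) (S : Finset (Pos n → F))
    (hS : ∀ x ∈ S, x ≠ 0 ∧ hammingNorm x < n) (hcard : S.card < D.Q ^ 2 - 1) :
    ∃ a b : Fin n → F, IsSelfDual (Submodule.span F (Set.range (generator a b).row)) ∧
      ∀ x ∈ S, x ∉ Submodule.span F (Set.range (generator a b).row) := by
  classical
  choose lift hlift hliftsum using D.exists_lift hn
  let T : Finset (L × L) := Finset.univ.filter fun p => p.1 ^ (D.Q + 1) + p.2 ^ (D.Q + 1) = -1
  have hT : ∀ p ∈ T, p.1 * D.σ p.1 + p.2 * D.σ p.2 = -1 := by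
    intro p hp
    rw [D.σ_apply, D.σ_apply, ← pow_succ', ← pow_succ']
    exact (Finset.mem_filter.mp hp).2
  have hsd : ∀ p ∈ T, IsSelfDual (Submodule.span F (Set.range
      (generator (lift p.1 s) (lift p.2 t)).row)) := by
    intro p hp
    rw [generator_eq]
    refine isSelfDual_span_row_fromCols_one _ (rightHalf_mul_transpose _ _ ?_)
    refine circ_mul_transpose_add D.χ_add D.σ_χ D.eq_const hn _ _ ?_ ?_
    · rw [hlift, hlift, hT p hp]
    · rw [hliftsum, hliftsum, hst]
  by_contra! hcon
  have hbad : ∀ p : L × L, ∃ x, p ∈ T → x ∈ S ∧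
      x ∈ Submodule.span F (Set.range (generator (lift p.1 s) (lift p.2 t)).row) := by
    intro p
    by_cases hp : p ∈ T
    · obtain ⟨x, hx⟩ := hcon _ _ (hsd p hp)
      exact ⟨x, fun _ => hx⟩
    · exact ⟨0, fun h => absurd h hp⟩
  choose f hf using hbad
  have hfib : ∀ x ∈ S, (T.filter fun p => f p = x).card ≤ D.Q := by
    intro x hx
    have hmem : ∀ p ∈ T.filter (fun p => f p = x), p.1 * D.σ p.1 + p.2 * D.σ p.2 = -1 ∧
        evalAt D.χ (x ∘ Sum.inr ∘ Sum.inl) = evalAt D.χ (x ∘ Sum.inl ∘ Sum.inl) * p.1 -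
          evalAt D.χ (x ∘ Sum.inl ∘ Sum.inr) * D.σ p.2 ∧
        evalAt D.χ (x ∘ Sum.inr ∘ Sum.inr) = evalAt D.χ (x ∘ Sum.inl ∘ Sum.inl) * p.2 +
          evalAt D.χ (x ∘ Sum.inl ∘ Sum.inr) * D.σ p.1 := by
      intro p hp
      obtain ⟨hpT, rfl⟩ := Finset.mem_filter.mp hp
      have := evalAt_of_mem_span_generator D (hf p hpT).2
      rw [hlift, hlift] at this
      exact ⟨hT p hpT, this⟩
    by_cases hUV : evalAt D.χ (x ∘ Sum.inl ∘ Sum.inl) ≠ 0 ∨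
        evalAt D.χ (x ∘ Sum.inl ∘ Sum.inr) ≠ 0
    · refine card_hermitian_line_le D.two_le (D.σ : L →+* L) D.σ_apply (fun y => ?_) hUV _ _ _ hmem
      change D.σ (D.σ y) = y
      rw [D.σ_apply, D.σ_apply, ← pow_mul, ← sq, ← D.card_eq, FiniteField.pow_card]
    · -- no code contains `x`: otherwise its four blocks would be constant, hence zero
      rw [not_or, not_not, not_not] at hUV
      refine le_of_eq_of_le (Finset.card_eq_zero.mpr ?_) (Nat.zero_le _)
      refine Finset.eq_empty_of_forall_notMem fun p hp => (hS x hx).1 ?_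
      obtain ⟨-, h1, h2⟩ := hmem p hp
      rw [hUV.1, hUV.2] at h1 h2
      have hz : ∀ e : Fin n → Pos n, Function.Injective e → evalAt D.χ (x ∘ e) = 0 →
          ∀ j, x (e j) = 0 := by
        intro e he h0
        obtain ⟨c, hc⟩ := D.eq_const _ h0
        exact congrFun (comp_eq_zero_of_const (hS x hx).2 he hc)
      funext i
      rcases i with (i | i) | (i | i)
      · exact hz _ (Sum.inl_injective.comp Sum.inl_injective) hUV.1 i
      · exact hz _ (Sum.inl_injective.comp Sum.inr_injective) hUV.2 i
      · exact hz _ (Sum.inr_injective.comp Sum.inl_injective) (by simpa using h1) i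
      · exact hz _ (Sum.inr_injective.comp Sum.inr_injective) (by simpa using h2) i
  have hle := Finset.card_le_mul_card_image_of_maps_to (f := f) (s := T) (t := S)
    (fun p hp => (hf p hp).1) D.Q hfib
  have hge : D.Q * (D.Q ^ 2 - 1) ≤ T.card := by
    have hneg : (-1 : L) ^ D.Q = -1 := by rw [← D.σ_apply, map_neg, map_one]
    refine le_card_hermitian_sphere D.two_le D.card_eq hneg fun x y => ?_
    simp only [← D.σ_apply, map_add]
  have hQ : 0 < D.Q := lt_of_lt_of_le two_pos D.two_le
  exact absurd (Nat.le_of_mul_le_mul_left (hge.trans hle) hQ) (not_le.mpr hcard)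

end Avoiding

/-! ### The minimum distance -/

section MinDist

theorem lt_minDist {F : Type*} [Field F] [DecidableEq F] {ι : Type*} [Fintype ι]
    {C : Submodule F (ι → F)} {x : ι → F} (hx : x ∈ C) (hx0 : x ≠ 0) {r : ℝ}
    (h : ∀ y ∈ C, y ≠ 0 → r < hammingNorm y) : r < minDist C := by
  obtain ⟨y, hy, z, hz, hyz, hd⟩ := Nat.sInf_mem
    (s := {d | ∃ x ∈ C, ∃ y ∈ C, x ≠ y ∧ hammingDist x y = d}) ⟨_, x, hx, 0, C.zero_mem, hx0, rfl⟩
  rw [minDist, ← hd, hammingDist_eq_hammingNorm]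
  exact h _ (C.add_mem (C.neg_mem hy) hz) fun h0 => hyz (neg_add_eq_zero.mp h0)

theorem generator_row_ne_zero {F : Type*} [Field F] {n : ℕ} [NeZero n] (a b : Fin n → F) :
    (generator a b).row (Sum.inl 0) ≠ 0 := by
  intro h
  have := congrFun h (Sum.inl (Sum.inl 0))
  simp [generator] at this

/-- A row of the generator matrix has a single nonzero entry in its left half, hence weight at most
`2 n + 1`. -/
theorem minDist_span_generator_le {F : Type*} [Field F] [DecidableEq F] {n : ℕ} [NeZero n]
    (a b : Fin n → F) :
    minDist (Submodule.span F (Set.range (generator a b).row)) ≤ 2 * n + 1 := by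
  have h : minDist (Submodule.span F (Set.range (generator a b).row)) ≤
      hammingDist ((generator a b).row (Sum.inl 0)) 0 :=
    Nat.sInf_le ⟨_, Submodule.subset_span (Set.mem_range_self (Sum.inl 0)), 0,
      Submodule.zero_mem _, generator_row_ne_zero a b, rfl⟩
  rw [hammingDist_zero_right] at h
  refine h.trans ?_
  calc hammingNorm ((generator a b).row (Sum.inl 0))
      ≤ (insert (Sum.inl (Sum.inl 0))
          (Finset.univ.map (Function.Embedding.inr (α := Fin n ⊕ Fin n)
            (β := Fin n ⊕ Fin n)))).card := by
        refine Finset.card_le_card fun i hi => ?_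
        rcases i with (i | i) | i
        · have : (0 : Fin n) = i := by
            by_contra h
            simp [generator, h] at hi
          simp [this]
        · simp [generator] at hi
        · simp
    _ ≤ 2 * n + 1 := by
        refine (Finset.card_insert_le _ _).trans ?_
        simp [two_mul]

end MinDist

/-! ### Good codes of a given length -/

theorem exists_sq_add_sq_eq_neg_one (F : Type*) [Field F] [Fintype F] :
    ∃ s t : F, s ^ 2 + t ^ 2 = -1 := by
  have : NeZero (ringChar F) := ⟨CharP.ringChar_ne_zero_of_finite F⟩
  obtain ⟨s, t, h⟩ := CharP.sq_add_sq F (ringChar F) (-1)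
  exact ⟨s, t, by simpa using h⟩

/-- For every odd prime `n` modulo which `q` is a primitive root, the counting argument applies
with the radius `4 n c`, where `H_q(c) = 1 / 8`: the ball has at most `q ^ (n / 2)` elements,
fewer than `Q² = q ^ (n - 1)`. -/
theorem exists_selfDual_code {F : Type*} [Field F] [Fintype F] [DecidableEq F] {n : ℕ}
    (hn : n.Prime) (hodd : Odd n) (hcop : Nat.gcd n (Fintype.card F) = 1)
    (hroot : IsPrimitiveRootMod (Fintype.card F) n) {c : ℝ} (hc0 : 0 < c) (hc4 : c < 1 / 4)
    (hc : Real.qaryEntropy (Fintype.card F) c = Real.log (Fintype.card F) / 8) :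
    ∃ C : Submodule F (Pos n → F), IsFourCirculant C ∧ IsSelfDual C ∧
      c * (4 * n) < minDist C ∧ minDist C ≤ 2 * n + 1 := by
  obtain ⟨m, hm⟩ := hodd
  have hm0 : 0 < m := by
    have := hn.two_le
    omega
  have : NeZero n := ⟨hn.ne_zero⟩
  have hnF : (n : F) ≠ 0 := by
    obtain ⟨f, hp, hf⟩ := FiniteField.card F (ringChar F)
    rw [Ne, ringChar.spec, Nat.prime_dvd_prime_iff_eq hp hn]
    rintro h
    rw [hf, h, Nat.gcd_eq_left (dvd_pow_self n (PNat.ne_zero f))] at hcop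
    exact hn.one_lt.ne' hcop
  obtain ⟨L, _, _, _, D, hQ⟩ := exists_cyclotomicData hn hm hm0 hcop hroot
  obtain ⟨s, t, hst⟩ := exists_sq_add_sq_eq_neg_one F
  have hq : (2 : ℝ) ≤ Fintype.card F := by exact_mod_cast Fintype.one_lt_card (α := F)
  have hcardPos : Fintype.card (Pos n) = 4 * n := by simp; ring
  let B : Finset (Pos n → F) :=
    Finset.univ.filter fun x => (hammingNorm x : ℝ) ≤ c * Fintype.card (Pos n)
  have hnpos : (0 : ℝ) < n := by exact_mod_cast hn.pos
  have h0B : (0 : Pos n → F) ∈ B := by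
    simp only [B, Finset.mem_filter, Finset.mem_univ, true_and, hammingNorm_zero, Nat.cast_zero]
    positivity
  have hB : B.card < D.Q ^ 2 := by
    have h1 := card_hammingBall_le (F := F) (ι := Pos n) hc0 (by
      have : 1 / (Fintype.card F : ℝ) ≤ 1 / 2 := one_div_le_one_div_of_le two_pos hq
      linarith)
    have hlog : 0 < Real.log (Fintype.card F) := Real.log_pos (by linarith)
    have h2 : Real.exp (Fintype.card (Pos n) * Real.qaryEntropy (Fintype.card F) c) <
        ((D.Q ^ 2 : ℕ) : ℝ) := by
      rw [hc, hcardPos, hQ, ← Real.exp_log (show (0 : ℝ) < (((Fintype.card F ^ m) ^ 2 : ℕ) : ℝ) by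
        positivity), Real.exp_lt_exp]
      push_cast
      rw [Real.log_pow, Real.log_pow, hm]
      have : (1 : ℝ) ≤ m := by exact_mod_cast hm0
      push_cast
      nlinarith
    exact_mod_cast h1.trans_lt h2
  obtain ⟨a, b, hsd, hav⟩ := exists_selfDual_avoiding D hnF hst (B.erase 0) (by
    intro x hx
    obtain ⟨hx0, hxB⟩ := Finset.mem_erase.mp hx
    refine ⟨hx0, ?_⟩
    have h := (Finset.mem_filter.mp hxB).2
    rw [hcardPos] at h
    push_cast at h
    have : (hammingNorm x : ℝ) < n := by nlinarith
    exact_mod_cast this) (by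
    rw [Finset.card_erase_of_mem h0B]
    have := Finset.card_pos.mpr ⟨_, h0B⟩
    omega)
  refine ⟨_, ⟨a, b, rfl⟩, hsd, ?_, minDist_span_generator_le a b⟩
  refine lt_minDist (Submodule.subset_span (Set.mem_range_self (Sum.inl 0))) (generator_row_ne_zero a b)
    fun y hy hy0 => ?_
  by_contra! h
  refine hav y (Finset.mem_erase.mpr ⟨hy0, Finset.mem_filter.mpr ⟨Finset.mem_univ _, ?_⟩⟩) hy
  rw [hcardPos]
  exact_mod_cast h

end FourCirculant

/-- For every finite field `F` of cardinality `q` and every infinite sequence of odd primes `n i`,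
coprime to `q`, modulo which `q` is a primitive root, there is a family of self-dual four
circulant codes `C i` over `F` of length `4 * n i` whose relative distance `δ` lies in the domain
of the `q`-ary entropy function and satisfies `H_q(δ) ≥ 1/8`. -/
theorem theorem4p5 {F : Type*} [Field F] [Fintype F] [DecidableEq F]
    (n : ℕ → ℕ) (hn : StrictMono n)
    (hprime : ∀ i, (n i).Prime ∧ Odd (n i))
    (hcop : ∀ i, Nat.gcd (n i) (Fintype.card F) = 1)
    (hroot : ∀ i, FourCirculant.IsPrimitiveRootMod (Fintype.card F) (n i)) :
    ∃ C : (i : ℕ) → Submodule F (FourCirculant.Pos (n i) → F),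
      (∀ i, FourCirculant.IsFourCirculant (C i) ∧ FourCirculant.IsSelfDual (C i)) ∧
      ∃ δ : ℝ,
        δ = Filter.liminf
          (fun i => (FourCirculant.minDist (C i) : ℝ) / (4 * (n i : ℝ))) Filter.atTop ∧
        0 ≤ δ ∧ δ ≤ ((Fintype.card F : ℝ) - 1) / (Fintype.card F : ℝ) ∧
        1 / 8 ≤ FourCirculant.qEntropy (Fintype.card F) δ := by
  have hq : 2 ≤ Fintype.card F := Fintype.one_lt_card
  have hq' : (2 : ℝ) ≤ Fintype.card F := by exact_mod_cast hq
  obtain ⟨c, hc0, hc4, hc⟩ := FourCirculant.exists_qaryEntropy_eq hq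
  choose C hC hsd hlow hup using fun i => FourCirculant.exists_selfDual_code (hprime i).1
    (hprime i).2 (hcop i) (hroot i) hc0 hc4 hc
  refine ⟨C, fun i => ⟨hC i, hsd i⟩, _, rfl, ?_⟩
  have hnpos : ∀ i, (0 : ℝ) < n i := fun i => by exact_mod_cast (hprime i).1.pos
  set u : ℕ → ℝ := fun i => (FourCirculant.minDist (C i) : ℝ) / (4 * (n i : ℝ)) with hu
  have hcu : ∀ i, c ≤ u i := fun i =>
    (le_div_iff₀ (mul_pos four_pos (hnpos i))).mpr (hlow i).le
  have huv : ∀ i, u i ≤ 1 / 2 + 1 / 4 * (n i : ℝ)⁻¹ := by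
    intro i
    have h : (FourCirculant.minDist (C i) : ℝ) ≤ 2 * n i + 1 := by exact_mod_cast hup i
    rw [hu]
    simp only
    rw [div_le_iff₀ (mul_pos four_pos (hnpos i))]
    have := (hnpos i).ne'
    field_simp
    linarith
  have hlim : Filter.Tendsto (fun i => 1 / 2 + 1 / 4 * (n i : ℝ)⁻¹) Filter.atTop
      (nhds (1 / 2 : ℝ)) := by
    have h := (tendsto_inv_atTop_zero.comp
      (tendsto_natCast_atTop_atTop.comp hn.tendsto_atTop) : Filter.Tendsto
        (fun i => (n i : ℝ)⁻¹) Filter.atTop (nhds 0))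
    simpa using (h.const_mul (1 / 4 : ℝ)).const_add (1 / 2 : ℝ)
  -- these two bounds keep the real `liminf` from taking a junk value
  have hbdd : Filter.IsBoundedUnder (· ≥ ·) Filter.atTop u :=
    Filter.isBoundedUnder_of ⟨c, hcu⟩
  have hcobdd : Filter.IsCoboundedUnder (· ≥ ·) Filter.atTop u :=
    (hlim.isBoundedUnder_le.mono_le (Filter.Eventually.of_forall huv)).isCoboundedUnder_ge
  have hδlow : c ≤ Filter.liminf u Filter.atTop :=
    Filter.le_liminf_of_le hcobdd (Filter.Eventually.of_forall hcu)
  have hδup : Filter.liminf u Filter.atTop ≤ 1 / 2 := by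
    rw [← hlim.liminf_eq]
    exact Filter.liminf_le_liminf (Filter.Eventually.of_forall huv) hbdd
      hlim.isCoboundedUnder_ge
  have hhalf : (1 : ℝ) / Fintype.card F ≤ 1 / 2 := one_div_le_one_div_of_le two_pos hq'
  refine ⟨hc0.le.trans hδlow, ?_, ?_⟩
  · rw [sub_div, div_self (by positivity)]
    linarith
  · have hmono := (Real.qaryEntropy_strictMonoOn hq).monotoneOn
      (show c ∈ Set.Icc (0 : ℝ) (1 - 1 / (Fintype.card F : ℝ)) from ⟨hc0.le, by linarith⟩)
      ⟨hc0.le.trans hδlow, by linarith⟩ hδlow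
    rw [hc] at hmono
    rw [FourCirculant.qEntropy_eq, le_div_iff₀ (Real.log_pos (by linarith))]
    linarith
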